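/- Let $\mathcal H$ be a finite-dimensional Hilbert space and $r>0$. Let $\mathcal A=\{\mathcal A_n\}_{n\ge1}$ and $\mathcal B=\{\mathcal B_n\}_{n\ge1}$ be two sequences of convex compact sets $\mathcal A_n,\mathcal B_n$ of density operators on $\mathcal H^{\otimes n}$ that are stable under tensor products, i.e. $\mathcal A_m\otimes\mathcal A_n\subseteq\mathcal A_{m+n}$ and $\mathcal B_m\otimes\mathcal B_n\subseteq\mathcal B_{m+n}$ for all $m,n\ge1$. Logarithms are to base two, all quantities take values in $[-\infty,+\infty]$, and $\inf\emptyset=+\infty$. For $\alpha\in(0,1)$ and states $\rho,\sigma$ let $$D_\alpha(\rho\|\sigma)=\tfrac1{\alpha-1}\log\operatorname{tr}\left[\rho^\alpha\sigma^{1-\alpha}\right]\ \text{ if }\operatorname{supp}\rho\subseteq\operatorname{supp}\sigma,\qquad D_\alpha(\rho\|\sigma)=+\infty\ \text{ otherwise}$$ (the Petz Rényi divergence), and $D_\alpha(\mathcal A_n\|\mathcal B_n)=\inf_{\rho\in\mathcal A_n,\,\sigma\in\mathcal B_n}D_\alpha(\rho\|\sigma)$. Let $$H_{n,r}(\mathcal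 A_n\|\mathcal B_n)=\inf_{\rho\in\mathcal A_n,\,\sigma\in\mathcal B_n}\ \sup_{\alpha\in(0,1)}\tfrac{\alpha-1}{\alpha}\left(nr-D_\alpha(\rho\|\sigma)\right).$$ The regularizations are $$H_r^\infty(\mathcal A\|\mathcal B)=\lim_{n\to\infty}\tfrac1nH_{n,r}(\mathcal A_n\|\mathcal B_n),\qquad D_\alpha^\infty(\mathcal A\|\mathcal B)=\lim_{n\to\infty}\tfrac1nD_\alpha(\mathcal A_n\|\mathcal B_n),$$ $$\mathbf H_r^\infty(\mathcal A\|\mathcal B)=\sup_{\alpha\in(0,1)}\tfrac{\alpha-1}{\alpha}\left(r-D_\alpha^\infty(\mathcal A\|\mathcal B)\right).$$ Then the following hold. 1. (Existence.) The limit defining $H_r^\infty(\mathcal A\|\mathcal B)$ exists in $[-\infty,+\infty]$ and equals $\inf_{n\ge1}\frac1nH_{n,r}(\mathcal A_n\|\mathcal B_n)$, unless $H_{n,r}(\mathcal A_n\|\mathcal B_n)$ is finite for some $n\ge1$ and $+\infty$ for infinitely many $n$. For each $\alpha\in(0,1)$, the limit defining $D_\alpha^\infty(\mathcal A\|\mathcal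 B)$ exists and equals $\inf_{n\ge1}\frac1nD_\alpha(\mathcal A_n\|\mathcal B_n)$, with the same exception for $D_\alpha(\mathcal A_n\|\mathcal B_n)$. 2. (Inequality.) Whenever these limits exist (that for $H$, and that for $D_\alpha$ for every $\alpha\in(0,1)$), $$H_r^\infty(\mathcal A\|\mathcal B)\ \ge\ \mathbf H_r^\infty(\mathcal A\|\mathcal B).$$ 3. Without any assumption on the existence of limits, the same inequality holds if all the limits over $n$, on both sides, are replaced by lower limits, or by upper limits, or if all the limits of $\frac1n(\cdot)$ are replaced by the infima over $n\ge1$ of the same sequences. -/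

import Mathlib

open Filter Topology
open scoped ComplexOrder

noncomputable section

namespace QHypothesis

/-- Operators on `ℋ^{⊗n}` for `ℋ = ℂ^d`, as matrices in the product basis, which is indexed by
the words of length `n` over `Fin d`. -/
abbrev Op (d n : ℕ) : Type := Matrix (Fin n → Fin d) (Fin n → Fin d) ℂ

/-- The density operators on `ℋ^{⊗n}`. -/
def density (d n : ℕ) : Set (Op d n) := {ρ | ρ.PosSemidef ∧ ρ.trace = 1}

/-- The tensor product `X ⊗ Y` as an operator on `ℋ^{⊗(m+n)} = ℋ^{⊗m} ⊗ ℋ^{⊗n}` (words are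
concatenated). -/
def tensor {d m n : ℕ} (X : Op d m) (Y : Op d n) : Op d (m + n) :=
  Matrix.reindex (Fin.appendEquiv m n) (Fin.appendEquiv m n) (Matrix.kronecker X Y)

/-- The support of a Hermitian operator (the orthogonal complement of its kernel), that is, its
range. -/
def supp {d n : ℕ} (X : Op d n) : Submodule ℂ ((Fin n → Fin d) → ℂ) :=
  LinearMap.range X.mulVecLin

/-- The power `X ^ p` of a positive semidefinite operator, by functional calculus. As
`0 ^ p = 0` for real `p ≠ 0`, such powers are taken on the support. -/
def power {d n : ℕ} (X : Op d n) (p : ℝ) : Op d n := cfc (fun x : ℝ => x ^ p) X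

/-- `Q_α(ρ‖σ) = tr[ρ^α σ^{1-α}]`, a nonnegative real number for positive semidefinite
arguments. -/
def petzQ {d n : ℕ} (α : ℝ) (ρ σ : Op d n) : ℝ := (power ρ α * power σ (1 - α)).trace.re

open Classical in
/-- The Petz Rényi divergence of order `α`, with logarithm to base two. For a state `ρ` with
`supp ρ ⊆ supp σ` the number `Q_α(ρ‖σ)` is positive. -/
def petzRenyi {d n : ℕ} (α : ℝ) (ρ σ : Op d n) : EReal :=
  if supp ρ ≤ supp σ then ((1 / (α - 1) * Real.logb 2 (petzQ α ρ σ) : ℝ) : EReal) else ⊤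

/-- The quantum Hoeffding divergence `H_{n,r}(ρ_n‖σ_n)`. -/
def hoeffding {d n : ℕ} (r : ℝ) (ρ σ : Op d n) : EReal :=
  ⨆ α ∈ Set.Ioo (0 : ℝ) 1,
    (((α - 1) / α : ℝ) : EReal) * (((n * r : ℝ) : EReal) - petzRenyi α ρ σ)

/-- The extension of a divergence to sets: the infimum over all pairs. -/
def setDiv {d n : ℕ} (D : Op d n → Op d n → EReal) (A B : Set (Op d n)) : EReal :=
  ⨅ ρ ∈ A, ⨅ σ ∈ B, D ρ σ

/-- The sequence `(1/n) 𝔻(A_n‖B_n)`. -/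
def rate {d : ℕ} (D : ∀ n, Op d n → Op d n → EReal) (A B : ∀ n, Set (Op d n)) (n : ℕ) : EReal :=
  (((1 : ℝ) / n : ℝ) : EReal) * setDiv (D n) (A n) (B n)

/-- The lower regularization of a divergence. -/
def lowerReg {d : ℕ} (D : ∀ n, Op d n → Op d n → EReal) (A B : ∀ n, Set (Op d n)) : EReal :=
  liminf (rate D A B) atTop

/-- The upper regularization of a divergence. -/
def upperReg {d : ℕ} (D : ∀ n, Op d n → Op d n → EReal) (A B : ∀ n, Set (Op d n)) : EReal :=
  limsup (rate D A B) atTop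

/-- The regularized divergence `𝔻^∞(A‖B) = lim (1/n) 𝔻(A_n‖B_n)` exists and equals `x`. -/
def HasReg {d : ℕ} (D : ∀ n, Op d n → Op d n → EReal) (A B : ∀ n, Set (Op d n)) (x : EReal) :
    Prop :=
  Tendsto (rate D A B) atTop (𝓝 x)

/-- If `𝔻(A_n‖B_n)` is finite for one `n ≥ 1`, then it is finite for all large `n`. -/
def NoRecurrentTop {d : ℕ} (D : ∀ n, Op d n → Op d n → EReal) (A B : ∀ n, Set (Op d n)) : Prop :=
  (∃ n, 1 ≤ n ∧ setDiv (D n) (A n) (B n) ≠ ⊤) → ∀ᶠ n in atTop, setDiv (D n) (A n) (B n) ≠ ⊤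

/-- The family of Petz Rényi divergences of order `α` on all tensor powers. -/
def petzFamily (d : ℕ) (α : ℝ) (n : ℕ) : Op d n → Op d n → EReal := petzRenyi α

/-- The family `H_{n,r}` of Hoeffding divergences on all tensor powers. -/
def hoeffdingFamily (d : ℕ) (r : ℝ) (n : ℕ) : Op d n → Op d n → EReal := hoeffding r

/-- The Hoeffding formula `sup_{α ∈ (0,1)} (α-1)/α (r - D_α)` for a family of numbers `D_α`.
With the regularized Petz Rényi divergences for `D_α` this is the second regularized Hoeffding
divergence. -/
def hoeffdingOf (r : ℝ) (D : ℝ → EReal) : EReal :=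
  ⨆ α ∈ Set.Ioo (0 : ℝ) 1, (((α - 1) / α : ℝ) : EReal) * ((r : EReal) - D α)

/-- Stability under tensor products: `C_m ⊗ C_n ⊆ C_{m+n}` for `m, n ≥ 1`. -/
def Stable {d : ℕ} (C : ∀ n, Set (Op d n)) : Prop :=
  ∀ m n, 1 ≤ m → 1 ≤ n → ∀ X ∈ C m, ∀ Y ∈ C n, tensor X Y ∈ C (m + n)

/-- A stable sequence of convex compact sets of states, indexed by `n ≥ 1` (the set with index
`0` plays no role). -/
structure IsStableStateSeq {d : ℕ} (C : ∀ n, Set (Op d n)) : Prop where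
  subset_density : ∀ n, 1 ≤ n → C n ⊆ density d n
  convex : ∀ n, 1 ≤ n → Convex ℝ (C n)
  compact : ∀ n, 1 ≤ n → IsCompact (C n)
  stable : Stable C

end QHypothesis

end

open QHypothesis

/-!
Existence of the regularizations is an instance of Fekete's lemma
(`tendsto_div_of_subadditive_ereal`), which needs nonnegativity and subadditivity on tensor products.
Nonnegativity of the Petz Rényi divergence is `Q_α ≤ 1` (`petzQ_le_one`), and that of the Hoeffding
divergence follows by letting `α` tend to `1`. For subadditivity, the functional calculus commutes
with tensor products (`power_tensor`), so `Q_α` is multiplicative (`petzQ_tensor`). When both support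
conditions hold, `Q_α` is moreover positive (`petzQ_pos`), hence `D_α` is additive
(`petzRenyi_tensor`), and the supremum over `α` of a sum is at most the sum of the suprema
(`hoeffding_tensor_le`). When one of them fails, the right-hand side of the subadditivity
inequality is `⊤`.

The inequality between the two regularizations is the trivial direction of a minimax exchange. The
terms `(α - 1) / α * (r - x)` of the Hoeffding formula are increasing in `x`, so for each `n` and `α`
the rate of the Hoeffding divergence dominates the term evaluated at the rate of `D_α`
(`hoeffding_term_rate_le`). The terms are also continuous in `x ∈ [-∞, ∞]`, so the bound survives
limits, lower and upper limits, and infima over `n`.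
-/

open QHypothesis

/-! ### Fekete's lemma in the extended reals -/

/-- Fekete's lemma for nonnegative extended sequences that are subadditive on the indices `n ≥ 1`.
The value `⊤` must not recur infinitely often once a finite value has occurred: the sequence that is
`0` at the multiples of some `k ≥ 2` and `⊤` elsewhere is subadditive, but `a n / n` diverges. -/
theorem tendsto_div_of_subadditive_ereal (a : ℕ → EReal) (h0 : ∀ n, 1 ≤ n → 0 ≤ a n)
    (hsub : ∀ m n, 1 ≤ m → 1 ≤ n → a (m + n) ≤ a m + a n)
    (hfin : (∃ n, 1 ≤ n ∧ a n ≠ ⊤) → ∀ᶠ n in atTop, a n ≠ ⊤) :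
    Tendsto (fun n : ℕ => (((1 : ℝ) / n : ℝ) : EReal) * a n) atTop
      (𝓝 (⨅ (n : ℕ) (_ : n ≥ 1), (((1 : ℝ) / n : ℝ) : EReal) * a n)) := by
  refine tendsto_of_le_liminf_of_limsup_le ?_ ?_
  · refine le_liminf_of_le (by isBoundedDefault) ?_
    filter_upwards [eventually_ge_atTop 1] with n hn
    exact iInf₂_le n hn
  refine le_iInf₂ fun k hk => ?_
  have hk0 : (0 : ℝ) < k := by exact_mod_cast hk
  by_cases hkt : a k = ⊤
  · rw [hkt, EReal.coe_mul_top_of_pos (by positivity)]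
    exact le_top
  obtain ⟨N, hN⟩ := eventually_atTop.1 (hfin ⟨k, hk, hkt⟩)
  set N' := max N 1 with hN'
  have hreal : ∀ n, 1 ≤ n → a n ≠ ⊤ → ((a n).toReal : EReal) = a n := fun n hn ht =>
    EReal.coe_toReal ht (ne_bot_of_le_ne_bot EReal.zero_ne_bot (h0 n hn))
  have hpos : ∀ n, 1 ≤ n → 0 ≤ (a n).toReal := fun n hn => EReal.toReal_nonneg (h0 n hn)
  set v := (a k).toReal
  set M := ∑ s ∈ Finset.Ico N' (N' + k), (a s).toReal
  -- removing blocks of length `k` leaves a remainder in the window `[N', N' + k)`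
  have key : ∀ n, N' ≤ n → a n ≤ ((n * v / k + M : ℝ) : EReal) := by
    intro n
    induction n using Nat.strong_induction_on with
    | _ n ih =>
      intro hn
      have hn1 : 1 ≤ n := le_trans (le_max_right _ _) hn
      by_cases hlt : n < N' + k
      · rw [← hreal n hn1 (hN n (le_trans (le_max_left _ _) hn)), EReal.coe_le_coe_iff]
        have h1 : (a n).toReal ≤ M :=
          Finset.single_le_sum (f := fun s => (a s).toReal)
            (fun s hs => hpos s (le_trans (le_max_right _ _) (Finset.mem_Ico.1 hs).1))
            (Finset.mem_Ico.2 ⟨hn, hlt⟩)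
        have h2 : 0 ≤ n * v / k := by
          have := hpos k hk
          positivity
        linarith
      · have hle : N' ≤ n - k := by omega
        have h1 := hsub (n - k) k (by omega) hk
        rw [show n - k + k = n by omega] at h1
        refine h1.trans ((add_le_add (ih (n - k) (by omega) hle) (hreal k hk hkt).ge).trans ?_)
        rw [← EReal.coe_add, EReal.coe_le_coe_iff, Nat.cast_sub (by omega)]
        apply le_of_eq
        field_simp
        ring
  have hb : ∀ᶠ n : ℕ in atTop,
      (((1 : ℝ) / n : ℝ) : EReal) * a n ≤ ((v / k + M / n : ℝ) : EReal) := by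
    filter_upwards [eventually_ge_atTop N'] with n hn
    have hn0 : (0 : ℝ) < n := by
      exact_mod_cast (le_trans (le_max_right _ _) hn : 1 ≤ n)
    refine (mul_le_mul_of_nonneg_left (key n hn)
      (EReal.coe_nonneg.2 (by positivity : (0 : ℝ) ≤ 1 / n))).trans ?_
    rw [← EReal.coe_mul, EReal.coe_le_coe_iff]
    apply le_of_eq
    field_simp
  have hlim : Tendsto (fun n : ℕ => ((v / k + M / n : ℝ) : EReal)) atTop
      (𝓝 ((v / k : ℝ) : EReal)) := by
    refine (continuous_coe_real_ereal.tendsto _).comp ?_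
    simpa using tendsto_const_nhds.add (tendsto_const_div_atTop_nhds_zero_nat M)
  refine (limsup_le_limsup hb).trans ?_
  rw [hlim.limsup_eq, ← hreal k hk hkt, ← EReal.coe_mul, EReal.coe_le_coe_iff]
  apply le_of_eq
  ring

/-! ### Functional calculus and traces in eigenbases -/

section Spectral

variable {ι : Type*} [Fintype ι] [DecidableEq ι]

theorem conj_diagonal_mul {W : Matrix ι ι ℂ} (hW : W.conjTranspose * W = 1) (e f : ι → ℂ) :
    W * Matrix.diagonal e * W.conjTranspose * (W * Matrix.diagonal f * W.conjTranspose) =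
      W * Matrix.diagonal (e * f) * W.conjTranspose := by
  calc _ = W * Matrix.diagonal e * (W.conjTranspose * W) * Matrix.diagonal f * W.conjTranspose := by
        simp only [Matrix.mul_assoc]
    _ = _ := by
        rw [hW, Matrix.mul_one, Matrix.mul_assoc W, Matrix.diagonal_mul_diagonal]; rfl

theorem aeval_conj_diagonal {W : Matrix ι ι ℂ} (hW : W.conjTranspose * W = 1) (e : ι → ℝ)
    (q : Polynomial ℝ) :
    Polynomial.aeval (W * Matrix.diagonal (fun i => (e i : ℂ)) * W.conjTranspose) q =
      W * Matrix.diagonal (fun i => ((q.eval (e i) : ℝ) : ℂ)) * W.conjTranspose := by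
  have hW' : W * W.conjTranspose = 1 := mul_eq_one_comm.1 hW
  induction q using Polynomial.induction_on' with
  | add p q hp hq =>
    rw [map_add, hp, hq, ← add_mul, ← mul_add, Matrix.diagonal_add]
    simp
  | monomial n c =>
    rw [Polynomial.aeval_monomial]
    have hp : ∀ n : ℕ, (W * Matrix.diagonal (fun i => (e i : ℂ)) * W.conjTranspose) ^ n =
        W * Matrix.diagonal (fun i => (e i : ℂ) ^ n) * W.conjTranspose := by
      intro n
      induction n with
      | zero => simp [hW']
      | succ n ih =>
        rw [pow_succ, ih, conj_diagonal_mul hW]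
        rfl
    rw [hp, ← Algebra.smul_def, ← Matrix.smul_mul, ← Matrix.mul_smul]
    congr 2
    ext i j
    by_cases h : i = j
    · subst h; simp
    · simp [h]

/-- The functional calculus in an arbitrary eigenbasis. It is computed here for any unitary
diagonalization because a product of eigenbases is an eigenbasis of a tensor product, but
not the one Mathlib selects for it. -/
theorem cfc_conj_diagonal {W : Matrix ι ι ℂ} (hW : W.conjTranspose * W = 1) (e : ι → ℝ)
    (f : ℝ → ℝ) :
    cfc f (W * Matrix.diagonal (fun i => (e i : ℂ)) * W.conjTranspose) =
      W * Matrix.diagonal (fun i => (f (e i) : ℂ)) * W.conjTranspose := by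
  set X := W * Matrix.diagonal (fun i => (e i : ℂ)) * W.conjTranspose with hX
  have hsa : IsSelfAdjoint X := by
    change star X = X
    rw [Matrix.star_eq_conjTranspose, hX]
    simp only [Matrix.conjTranspose_mul, Matrix.conjTranspose_conjTranspose,
      Matrix.diagonal_conjTranspose, Matrix.mul_assoc]
    congr 3
    ext i
    simp
  -- on the finite set of all points involved, `f` is a polynomial
  set s : Finset ℝ := Finset.univ.image e ∪ (Matrix.finite_real_spectrum (A := X)).toFinset
  set q := Lagrange.interpolate s id f
  have hq : ∀ x ∈ s, q.eval x = f x := fun x hx =>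
    Lagrange.eval_interpolate_at_node (v := id) f Function.injective_id.injOn hx
  have h1 : cfc f X = cfc q.eval X := cfc_congr fun x hx => (hq x (by
    simp only [s, Finset.mem_union, Set.Finite.mem_toFinset]; exact Or.inr hx)).symm
  rw [h1, cfc_polynomial q X hsa, hX, aeval_conj_diagonal hW]
  congr 3
  ext i
  rw [hq (e i) (Finset.mem_union_left _ (Finset.mem_image_of_mem _ (Finset.mem_univ i)))]

theorem exists_eq_conj_diagonal {X : Matrix ι ι ℂ} (hX : X.PosSemidef) :
    ∃ (W : Matrix ι ι ℂ) (e : ι → ℝ), W.conjTranspose * W = 1 ∧ (∀ i, 0 ≤ e i) ∧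
      X = W * Matrix.diagonal (fun i => (e i : ℂ)) * W.conjTranspose := by
  refine ⟨hX.isHermitian.eigenvectorUnitary, hX.isHermitian.eigenvalues,
    Unitary.coe_star_mul_self _, hX.eigenvalues_nonneg, ?_⟩
  conv_lhs => rw [hX.isHermitian.spectral_theorem]
  rfl

/-- The trace of a product of two operators through their eigenvalues and the squared overlaps of
their eigenvectors. -/
theorem trace_conj_diagonal_mul (V W : Matrix ι ι ℂ) (e f : ι → ℝ) :
    (V * Matrix.diagonal (fun i => (e i : ℂ)) * V.conjTranspose *
      (W * Matrix.diagonal (fun i => (f i : ℂ)) * W.conjTranspose)).trace =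
      ((∑ i, ∑ j, e i * f j * Complex.normSq ((V.conjTranspose * W) i j) : ℝ) : ℂ) := by
  set U := V.conjTranspose * W with hU
  have h1 : (V * Matrix.diagonal (fun i => (e i : ℂ)) * V.conjTranspose *
      (W * Matrix.diagonal (fun i => (f i : ℂ)) * W.conjTranspose)).trace =
      (Matrix.diagonal (fun i => (e i : ℂ)) * U * (Matrix.diagonal (fun i => (f i : ℂ)) *
        U.conjTranspose)).trace := by
    rw [Matrix.mul_assoc V, Matrix.mul_assoc V, Matrix.trace_mul_comm V, hU,
      Matrix.conjTranspose_mul, Matrix.conjTranspose_conjTranspose]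
    simp only [Matrix.mul_assoc]
  rw [h1, Matrix.trace, Complex.ofReal_sum]
  refine Finset.sum_congr rfl fun i _ => ?_
  rw [Matrix.diag_apply, Matrix.mul_apply, Complex.ofReal_sum]
  refine Finset.sum_congr rfl fun j _ => ?_
  rw [Matrix.diagonal_mul, Matrix.diagonal_mul, Matrix.conjTranspose_apply]
  push_cast
  rw [Complex.normSq_eq_conj_mul_self]
  simp only [RCLike.star_def]
  ring

theorem trace_conj_diagonal {W : Matrix ι ι ℂ} (hW : W.conjTranspose * W = 1) (e : ι → ℝ) :
    (W * Matrix.diagonal (fun i => (e i : ℂ)) * W.conjTranspose).trace = ((∑ i, e i : ℝ) : ℂ) := by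
  rw [Matrix.trace_mul_comm, ← Matrix.mul_assoc, hW, Matrix.one_mul, Matrix.trace_diagonal]
  push_cast
  rfl

theorem sum_normSq_row {U : Matrix ι ι ℂ} (hU : U * U.conjTranspose = 1) (i : ι) :
    ∑ j, Complex.normSq (U i j) = 1 := by
  have h := congrFun (congrFun hU i) i
  rw [Matrix.mul_apply, Matrix.one_apply_eq] at h
  have h2 : ((∑ j, Complex.normSq (U i j) : ℝ) : ℂ) = 1 := by
    rw [← h]
    push_cast
    refine Finset.sum_congr rfl fun j _ => ?_
    rw [Matrix.conjTranspose_apply, RCLike.star_def, Complex.mul_conj]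
  exact_mod_cast h2

theorem sum_normSq_col {U : Matrix ι ι ℂ} (hU : U.conjTranspose * U = 1) (j : ι) :
    ∑ i, Complex.normSq (U i j) = 1 := by
  have := sum_normSq_row (U := U.conjTranspose) (by simpa using hU) j
  simpa [Complex.normSq_conj] using this

end Spectral

/-! ### Tensor products of operators -/

section Tensor

variable {d m n : ℕ}

theorem tensor_mul_tensor (X X' : Op d m) (Y Y' : Op d n) :
    tensor X Y * tensor X' Y' = tensor (X * X') (Y * Y') := by
  simp only [tensor, Matrix.reindex_apply, Matrix.submatrix_mul_equiv, Matrix.kronecker]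
  rw [← Matrix.mul_kronecker_mul]

theorem trace_tensor (X : Op d m) (Y : Op d n) : (tensor X Y).trace = X.trace * Y.trace := by
  rw [← Matrix.trace_kronecker]
  simp only [tensor, Matrix.trace, Matrix.reindex_apply, Matrix.diag_apply,
    Matrix.submatrix_apply, Matrix.kronecker]
  exact Equiv.sum_comp (Fin.appendEquiv m n).symm
    (fun i => Matrix.kroneckerMap (fun x y => x * y) X Y i i)

theorem conjTranspose_tensor (X : Op d m) (Y : Op d n) :
    (tensor X Y).conjTranspose = tensor X.conjTranspose Y.conjTranspose := by
  simp only [tensor, Matrix.reindex_apply, Matrix.conjTranspose_submatrix, Matrix.kronecker]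
  rw [Matrix.conjTranspose_kronecker]

theorem tensor_one_one : tensor (1 : Op d m) (1 : Op d n) = 1 := by
  simp only [tensor, Matrix.reindex_apply, Matrix.kronecker]
  rw [Matrix.one_kronecker_one, Matrix.submatrix_one_equiv]

/-- Tensoring multiplies eigenvalues; a word of length `m + n` is split into its first `m` and its
last `n` letters. -/
theorem tensor_diagonal (e : (Fin m → Fin d) → ℝ) (f : (Fin n → Fin d) → ℝ) :
    tensor (Matrix.diagonal fun i => (e i : ℂ)) (Matrix.diagonal fun i => (f i : ℂ)) =
      Matrix.diagonal fun k =>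
        ((e ((Fin.appendEquiv m n).symm k).1 * f ((Fin.appendEquiv m n).symm k).2 : ℝ) : ℂ) := by
  simp only [tensor, Matrix.reindex_apply, Matrix.kronecker]
  rw [Matrix.diagonal_kronecker_diagonal, Matrix.submatrix_diagonal_equiv]
  congr 1
  ext k
  simp

theorem power_tensor {X : Op d m} {Y : Op d n} (hX : X.PosSemidef) (hY : Y.PosSemidef) (p : ℝ) :
    power (tensor X Y) p = tensor (power X p) (power Y p) := by
  obtain ⟨V, e, hV, he, rfl⟩ := exists_eq_conj_diagonal hX
  obtain ⟨W, f, hW, hf, rfl⟩ := exists_eq_conj_diagonal hY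
  have hVW : (tensor V W).conjTranspose * tensor V W = 1 := by
    rw [conjTranspose_tensor, tensor_mul_tensor, hV, hW, tensor_one_one]
  simp only [power]
  rw [cfc_conj_diagonal hV, cfc_conj_diagonal hW]
  simp only [← tensor_mul_tensor, ← conjTranspose_tensor, tensor_diagonal]
  rw [cfc_conj_diagonal hVW]
  congr 3
  ext k
  rw [Real.mul_rpow (he _) (hf _)]

/-- Inclusion of ranges as divisibility, a form that is visibly stable under tensor products. -/
theorem supp_le_supp_iff {X Y : Op d n} : supp X ≤ supp Y ↔ ∃ Z, X = Y * Z := by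
  constructor
  · intro h
    have h1 : ∀ j, ∃ z, Y.mulVec z = X.col j := fun j =>
      h ⟨Pi.single j 1, by simp⟩
    choose z hz using h1
    refine ⟨Matrix.of fun i j => z j i, ?_⟩
    ext i j
    exact (congrFun (hz j) i).symm
  · rintro ⟨Z, rfl⟩
    rw [supp, supp, Matrix.mulVecLin_mul]
    exact LinearMap.range_comp_le_range _ _

theorem supp_tensor_le {X X' : Op d m} {Y Y' : Op d n} (h : supp X ≤ supp X')
    (h' : supp Y ≤ supp Y') : supp (tensor X Y) ≤ supp (tensor X' Y') := by
  obtain ⟨Z, rfl⟩ := supp_le_supp_iff.1 h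
  obtain ⟨Z', rfl⟩ := supp_le_supp_iff.1 h'
  exact supp_le_supp_iff.2 ⟨tensor Z Z', (tensor_mul_tensor _ _ _ _).symm⟩

end Tensor

/-! ### The quantity `Q_α` -/

section Petz

variable {d m n : ℕ} {α : ℝ}

/-- For states `ρ`, `σ` with spectra `e`, `f`, all the traces `tr[ρ^α σ^(1-α)]` are sums against
one and the same doubly stochastic matrix `w`, the squared overlaps of the eigenvectors. -/
theorem exists_trace_eq_sum {ρ σ : Op d n} (hρ : ρ ∈ density d n) (hσ : σ ∈ density d n) :
    ∃ (e f : (Fin n → Fin d) → ℝ) (w : (Fin n → Fin d) → (Fin n → Fin d) → ℝ),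
      (∀ i, 0 ≤ e i) ∧ (∀ j, 0 ≤ f j) ∧ (∀ i j, 0 ≤ w i j) ∧ ∑ i, e i = 1 ∧ ∑ j, f j = 1 ∧
      (∀ i, ∑ j, w i j = 1) ∧ (∀ j, ∑ i, w i j = 1) ∧
      (ρ * σ).trace = ((∑ i, ∑ j, e i * f j * w i j : ℝ) : ℂ) ∧
      ∀ α, (power ρ α * power σ (1 - α)).trace =
        ((∑ i, ∑ j, e i ^ α * f j ^ (1 - α) * w i j : ℝ) : ℂ) := by
  obtain ⟨hρ, hρ1⟩ := hρ
  obtain ⟨hσ, hσ1⟩ := hσ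
  obtain ⟨V, e, hV, he, rfl⟩ := exists_eq_conj_diagonal hρ
  obtain ⟨W, f, hW, hf, rfl⟩ := exists_eq_conj_diagonal hσ
  have hV' : V * V.conjTranspose = 1 := mul_eq_one_comm.1 hV
  have hW' : W * W.conjTranspose = 1 := mul_eq_one_comm.1 hW
  rw [trace_conj_diagonal hV] at hρ1
  rw [trace_conj_diagonal hW] at hσ1
  have hU : V.conjTranspose * W * (V.conjTranspose * W).conjTranspose = 1 := by
    rw [Matrix.conjTranspose_mul, Matrix.conjTranspose_conjTranspose, Matrix.mul_assoc,
      ← Matrix.mul_assoc W, hW', Matrix.one_mul, hV]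
  refine ⟨e, f, fun i j => Complex.normSq ((V.conjTranspose * W) i j), he, hf,
    fun i j => Complex.normSq_nonneg _, by exact_mod_cast hρ1, by exact_mod_cast hσ1,
    sum_normSq_row hU, sum_normSq_col (mul_eq_one_comm.1 hU), trace_conj_diagonal_mul _ _ _ _,
    fun α => ?_⟩
  rw [power, power, cfc_conj_diagonal hV, cfc_conj_diagonal hW, trace_conj_diagonal_mul]

/-- The weighted inequality of arithmetic and geometric means bounds each `e i ^ α * f j ^ (1 - α)`
by `α * e i + (1 - α) * f j`, and these bounds sum to `1` against a doubly stochastic matrix. -/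
theorem petzQ_le_one {ρ σ : Op d n} (hρ : ρ ∈ density d n) (hσ : σ ∈ density d n)
    (hα : α ∈ Set.Ioo (0 : ℝ) 1) : petzQ α ρ σ ≤ 1 := by
  obtain ⟨e, f, w, he, hf, hw, he1, hf1, hr, hc, -, hQ⟩ := exists_trace_eq_sum hρ hσ
  rw [petzQ, hQ, Complex.ofReal_re]
  calc ∑ i, ∑ j, e i ^ α * f j ^ (1 - α) * w i j
      ≤ ∑ i, ∑ j, (α * e i + (1 - α) * f j) * w i j := by
        refine Finset.sum_le_sum fun i _ => Finset.sum_le_sum fun j _ => ?_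
        refine mul_le_mul_of_nonneg_right ?_ (hw i j)
        exact Real.geom_mean_le_arith_mean2_weighted hα.1.le (by linarith [hα.2]) (he i) (hf j)
          (by ring)
    _ = α * ∑ i, e i * ∑ j, w i j + (1 - α) * ∑ j, f j * ∑ i, w i j := by
        simp only [add_mul, Finset.sum_add_distrib, Finset.mul_sum, mul_assoc]
        rw [Finset.sum_comm (f := fun i j => (1 - α) * (f j * w i j))]
    _ = 1 := by
        simp only [hr, hc, mul_one, he1, hf1]
        ring

open scoped MatrixOrder Matrix.Norms.L2Operator in
/-- A state is not orthogonal to an operator whose support contains its own: otherwise `ρ * σ = 0`,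
and `ρ = σ * Z` gives `ρ * ρ = 0`. -/
theorem trace_mul_ne_zero {ρ σ : Op d n} (hρ : ρ ∈ density d n) (hσ : σ.PosSemidef)
    (hs : supp ρ ≤ supp σ) : (ρ * σ).trace ≠ 0 := by
  intro h0
  obtain ⟨R, hR⟩ := CStarAlgebra.nonneg_iff_eq_star_mul_self.1 hρ.1.nonneg
  obtain ⟨S, hS⟩ := CStarAlgebra.nonneg_iff_eq_star_mul_self.1 hσ.nonneg
  rw [Matrix.star_eq_conjTranspose] at hR hS
  -- the trace is the squared Hilbert-Schmidt norm of `R * Sᴴ`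
  have hRS : R * S.conjTranspose = 0 := by
    rw [← Matrix.trace_mul_conjTranspose_self_eq_zero_iff, ← h0, hR, hS, Matrix.conjTranspose_mul,
      Matrix.conjTranspose_conjTranspose, Matrix.mul_assoc R.conjTranspose,
      Matrix.trace_mul_comm R.conjTranspose]
    simp only [Matrix.mul_assoc]
  have hmul : ρ * σ = 0 := by
    rw [hR, hS, Matrix.mul_assoc, ← Matrix.mul_assoc R, hRS, Matrix.zero_mul, Matrix.mul_zero]
  obtain ⟨Z, hZ⟩ := supp_le_supp_iff.1 hs
  have hsq : ρ.conjTranspose * ρ = 0 := by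
    rw [hρ.1.isHermitian.eq]
    nth_rw 2 [hZ]
    rw [← Matrix.mul_assoc, hmul, Matrix.zero_mul]
  have hρ0 : ρ = 0 := Matrix.conjTranspose_mul_self_eq_zero.1 hsq
  have h1 := hρ.2
  rw [hρ0, Matrix.trace_zero] at h1
  exact zero_ne_one h1

/-- Positivity guards the logarithm in `petzRenyi`. A nonzero term of `tr[ρ σ]` has positive factors,
hence the corresponding term of `Q_α` is positive. -/
theorem petzQ_pos {ρ σ : Op d n} (hρ : ρ ∈ density d n) (hσ : σ ∈ density d n)
    (hs : supp ρ ≤ supp σ) : 0 < petzQ α ρ σ := by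
  have hne := trace_mul_ne_zero hρ hσ.1 hs
  obtain ⟨e, f, w, he, hf, hw, -, -, -, -, ht, hQ⟩ := exists_trace_eq_sum hρ hσ
  rw [ht, Complex.ofReal_ne_zero] at hne
  obtain ⟨i, -, hi⟩ := Finset.exists_ne_zero_of_sum_ne_zero hne
  obtain ⟨j, -, hij⟩ := Finset.exists_ne_zero_of_sum_ne_zero hi
  rw [petzQ, hQ, Complex.ofReal_re]
  have hnn : ∀ i j, 0 ≤ e i ^ α * f j ^ (1 - α) * w i j := fun i j =>
    mul_nonneg (mul_nonneg (Real.rpow_nonneg (he i) _) (Real.rpow_nonneg (hf j) _)) (hw i j)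
  refine Finset.sum_pos' (fun i _ => Finset.sum_nonneg fun j _ => hnn i j)
    ⟨i, Finset.mem_univ i, Finset.sum_pos' (fun j _ => hnn i j) ⟨j, Finset.mem_univ j, ?_⟩⟩
  have hei : 0 < e i := (he i).lt_of_ne (by rintro h; simp [← h] at hij)
  have hfj : 0 < f j := (hf j).lt_of_ne (by rintro h; simp [← h] at hij)
  have hwij : 0 < w i j := (hw i j).lt_of_ne (by rintro h; simp [← h] at hij)
  positivity

theorem petzQ_tensor {ρ σ : Op d m} {ρ' σ' : Op d n} (hρ : ρ ∈ density d m)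
    (hσ : σ ∈ density d m) (hρ' : ρ'.PosSemidef) (hσ' : σ'.PosSemidef) :
    petzQ α (tensor ρ ρ') (tensor σ σ') = petzQ α ρ σ * petzQ α ρ' σ' := by
  -- as this trace is real, the real part of the product of traces is the product of real parts
  have him : (power ρ α * power σ (1 - α)).trace.im = 0 := by
    obtain ⟨e, f, w, -, -, -, -, -, -, -, -, hQ⟩ := exists_trace_eq_sum hρ hσ
    rw [hQ, Complex.ofReal_im]
  rw [petzQ, power_tensor hρ.1 hρ', power_tensor hσ.1 hσ', tensor_mul_tensor, trace_tensor,
    Complex.mul_re, him, zero_mul, sub_zero]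
  rfl

end Petz

/-! ### Divergences and their regularizations -/

section Divergences

variable {d m n : ℕ} {α : ℝ}

theorem petzRenyi_nonneg {ρ σ : Op d n} (hρ : ρ ∈ density d n) (hσ : σ ∈ density d n)
    (hα : α ∈ Set.Ioo (0 : ℝ) 1) : 0 ≤ petzRenyi α ρ σ := by
  rw [petzRenyi]
  split_ifs with hs
  · rw [EReal.coe_nonneg]
    refine mul_nonneg_of_nonpos_of_nonpos
      (div_nonpos_of_nonneg_of_nonpos zero_le_one (by linarith [hα.2]))
      (Real.logb_nonpos one_lt_two (petzQ_pos hρ hσ hs).le (petzQ_le_one hρ hσ hα))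
  · exact le_top

theorem petzRenyi_tensor {ρ σ : Op d m} {ρ' σ' : Op d n} (hρ : ρ ∈ density d m)
    (hσ : σ ∈ density d m) (hρ' : ρ' ∈ density d n) (hσ' : σ' ∈ density d n)
    (hs : supp ρ ≤ supp σ) (hs' : supp ρ' ≤ supp σ') :
    petzRenyi α (tensor ρ ρ') (tensor σ σ') = petzRenyi α ρ σ + petzRenyi α ρ' σ' := by
  rw [petzRenyi, petzRenyi, petzRenyi, if_pos hs, if_pos hs', if_pos (supp_tensor_le hs hs'),
    petzQ_tensor hρ hσ hρ'.1 hσ'.1,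
    Real.logb_mul (petzQ_pos hρ hσ hs).ne' (petzQ_pos hρ' hσ' hs').ne', mul_add, EReal.coe_add]

theorem petzRenyi_tensor_le {ρ σ : Op d m} {ρ' σ' : Op d n} (hα : α ∈ Set.Ioo (0 : ℝ) 1)
    (hρ : ρ ∈ density d m) (hσ : σ ∈ density d m) (hρ' : ρ' ∈ density d n)
    (hσ' : σ' ∈ density d n) :
    petzRenyi α (tensor ρ ρ') (tensor σ σ') ≤ petzRenyi α ρ σ + petzRenyi α ρ' σ' := by
  by_cases hs : supp ρ ≤ supp σ
  · by_cases hs' : supp ρ' ≤ supp σ'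
    · exact (petzRenyi_tensor hρ hσ hρ' hσ' hs hs').le
    · rw [petzRenyi.eq_def α ρ' σ', if_neg hs', EReal.add_top_of_ne_bot
        (ne_bot_of_le_ne_bot EReal.zero_ne_bot (petzRenyi_nonneg hρ hσ hα))]
      exact le_top
  · rw [petzRenyi.eq_def α ρ σ, if_neg hs, EReal.top_add_of_ne_bot
      (ne_bot_of_le_ne_bot EReal.zero_ne_bot (petzRenyi_nonneg hρ' hσ' hα))]
    exact le_top

/-- The terms of the Hoeffding formula increase with the divergence since `(α - 1) / α < 0`. -/
theorem monotone_hoeffding_term (hα : α ∈ Set.Ioo (0 : ℝ) 1) (r : ℝ) :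
    Monotone fun x : EReal => (((α - 1) / α : ℝ) : EReal) * ((r : EReal) - x) := by
  intro x y hxy
  have hc : (α - 1) / α ≤ 0 := div_nonpos_of_nonpos_of_nonneg (by linarith [hα.2]) hα.1.le
  have h := mul_le_mul_of_nonneg_left (EReal.sub_le_sub (le_refl (r : EReal)) hxy)
    (EReal.coe_nonneg.2 (neg_nonneg.2 hc))
  rw [EReal.coe_neg, EReal.neg_mul, EReal.neg_mul, EReal.neg_le_neg_iff] at h
  exact h

theorem continuous_hoeffding_term (hα : α ∈ Set.Ioo (0 : ℝ) 1) (r : ℝ) :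
    Continuous fun x : EReal => (((α - 1) / α : ℝ) : EReal) * ((r : EReal) - x) := by
  have hc : (α - 1) / α ≠ 0 := (div_neg_of_neg_of_pos (by linarith [hα.2]) hα.1).ne
  have hsub : Continuous fun x : EReal => (r : EReal) - x := by
    rw [continuous_iff_continuousAt]
    intro x
    exact (EReal.continuousAt_add (p := ((r : EReal), -x)) (by simp) (by simp)).comp
      (f := fun x : EReal => ((r : EReal), -x)) (by fun_prop)
  rw [continuous_iff_continuousAt]
  intro x
  refine ContinuousAt.comp (f := fun x : EReal => ((((α - 1) / α : ℝ) : EReal), (r : EReal) - x))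
    (EReal.continuousAt_mul ?_ ?_ ?_ ?_) (by fun_prop) <;> simp [hc]

/-- As `D_α ≥ 0`, the term of order `α` is at least `(α - 1) / α * (n * r)`, which tends to `0` as
`α` tends to `1`. -/
theorem hoeffding_nonneg (r : ℝ) {ρ σ : Op d n} (hρ : ρ ∈ density d n) (hσ : σ ∈ density d n) :
    0 ≤ hoeffding r ρ σ := by
  have hlim : Tendsto (fun α : ℝ => (((α - 1) / α * (n * r) : ℝ) : EReal)) (𝓝[<] 1) (𝓝 0) := by
    have h : ContinuousAt (fun α : ℝ => (α - 1) / α * (n * r)) 1 := by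
      fun_prop (disch := norm_num)
    have h2 := (continuous_coe_real_ereal.tendsto _).comp h.tendsto
    simp only [sub_self, zero_div, zero_mul, EReal.coe_zero] at h2
    exact h2.mono_left nhdsWithin_le_nhds
  refine le_of_tendsto hlim ?_
  filter_upwards [Ioo_mem_nhdsLT (zero_lt_one' ℝ)] with α hα
  refine le_iSup₂_of_le α hα ?_
  have h := monotone_hoeffding_term hα (n * r) (petzRenyi_nonneg hρ hσ hα)
  simp only [sub_zero, ← EReal.coe_mul] at h
  exact h

theorem hoeffding_eq_top (r : ℝ) {ρ σ : Op d n} (hs : ¬ supp ρ ≤ supp σ) :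
    hoeffding r ρ σ = ⊤ := by
  have hα : (1 / 2 : ℝ) ∈ Set.Ioo (0 : ℝ) 1 := by norm_num
  refine top_le_iff.1 (le_iSup₂_of_le (1 / 2 : ℝ) hα ?_)
  rw [petzRenyi, if_neg hs, EReal.sub_top, EReal.coe_mul_bot_of_neg (by norm_num)]

theorem hoeffding_tensor_le (r : ℝ) {ρ σ : Op d m} {ρ' σ' : Op d n}
    (hρ : ρ ∈ density d m) (hσ : σ ∈ density d m) (hρ' : ρ' ∈ density d n)
    (hσ' : σ' ∈ density d n) :
    hoeffding r (tensor ρ ρ') (tensor σ σ') ≤ hoeffding r ρ σ + hoeffding r ρ' σ' := by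
  by_cases hs : supp ρ ≤ supp σ
  · by_cases hs' : supp ρ' ≤ supp σ'
    · refine iSup₂_le fun α hα => ?_
      refine le_trans ?_ (add_le_add (le_iSup₂_of_le α hα le_rfl) (le_iSup₂_of_le α hα le_rfl))
      rw [petzRenyi_tensor hρ hσ hρ' hσ' hs hs', petzRenyi.eq_def α ρ σ, petzRenyi.eq_def α ρ' σ',
        if_pos hs, if_pos hs']
      norm_cast
      apply le_of_eq
      push_cast
      ring
    · rw [hoeffding_eq_top r hs', EReal.add_top_of_ne_bot
        (ne_bot_of_le_ne_bot EReal.zero_ne_bot (hoeffding_nonneg r hρ hσ))]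
      exact le_top
  · rw [hoeffding_eq_top r hs, EReal.top_add_of_ne_bot
      (ne_bot_of_le_ne_bot EReal.zero_ne_bot (hoeffding_nonneg r hρ' hσ'))]
    exact le_top

theorem setDiv_nonneg {D : Op d n → Op d n → EReal} {A B : Set (Op d n)}
    (hD : ∀ ρ ∈ A, ∀ σ ∈ B, 0 ≤ D ρ σ) : 0 ≤ setDiv D A B :=
  le_iInf₂ fun ρ hρ => le_iInf₂ fun σ hσ => hD ρ hρ σ hσ

theorem setDiv_lt_iff {D : Op d n → Op d n → EReal} {A B : Set (Op d n)} {x : EReal} :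
    setDiv D A B < x ↔ ∃ ρ ∈ A, ∃ σ ∈ B, D ρ σ < x := by
  simp only [setDiv, iInf_lt_iff, exists_prop]

/-- A nonnegative divergence that is subadditive on tensor products of states regularizes on stable
sequences. -/
theorem hasReg_of_tensor_le {D : ∀ n, Op d n → Op d n → EReal} {A B : ∀ n, Set (Op d n)}
    (hA : IsStableStateSeq A) (hB : IsStableStateSeq B)
    (h0 : ∀ n, ∀ ρ ∈ density d n, ∀ σ ∈ density d n, 0 ≤ D n ρ σ)
    (hsub : ∀ m n, ∀ ρ ∈ density d m, ∀ σ ∈ density d m, ∀ ρ' ∈ density d n, ∀ σ' ∈ density d n,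
      D (m + n) (tensor ρ ρ') (tensor σ σ') ≤ D m ρ σ + D n ρ' σ')
    (hfin : NoRecurrentTop D A B) : HasReg D A B (⨅ n ≥ 1, rate D A B n) := by
  have hnn : ∀ n, 1 ≤ n → 0 ≤ setDiv (D n) (A n) (B n) := fun n hn =>
    setDiv_nonneg fun ρ hρ σ hσ =>
      h0 n ρ (hA.subset_density n hn hρ) σ (hB.subset_density n hn hσ)
  refine tendsto_div_of_subadditive_ereal (fun n => setDiv (D n) (A n) (B n)) hnn ?_ hfin
  intro m n hm hn
  refine EReal.le_add_of_forall_gt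
    (Or.inl (ne_bot_of_le_ne_bot EReal.zero_ne_bot (hnn m hm)))
    (Or.inr (ne_bot_of_le_ne_bot EReal.zero_ne_bot (hnn n hn))) ?_
  intro x hx y hy
  obtain ⟨ρ, hρ, σ, hσ, hlt⟩ := setDiv_lt_iff.1 hx
  obtain ⟨ρ', hρ', σ', hσ', hlt'⟩ := setDiv_lt_iff.1 hy
  refine (iInf₂_le_of_le _ (hA.stable m n hm hn ρ hρ ρ' hρ')
    (iInf₂_le _ (hB.stable m n hm hn σ hσ σ' hσ'))).trans ?_
  exact (hsub m n ρ (hA.subset_density m hm hρ) σ (hB.subset_density m hm hσ)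
    ρ' (hA.subset_density n hn hρ') σ' (hB.subset_density n hn hσ')).trans
    (add_le_add hlt.le hlt'.le)

/-- The trivial half of the minimax inequality, at a fixed `n`: the infimum over pairs of states of
the supremum over `α` is at least each term of the Hoeffding formula at the infimum. -/
theorem hoeffding_term_rate_le (hα : α ∈ Set.Ioo (0 : ℝ) 1) (r : ℝ) (A B : ∀ n, Set (Op d n))
    (hn : 1 ≤ n) :
    (((α - 1) / α : ℝ) : EReal) * ((r : EReal) - rate (petzFamily d α) A B n) ≤
      rate (hoeffdingFamily d r) A B n := by
  have hn0 : (0 : ℝ) < n := by exact_mod_cast hn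
  have hc : (α - 1) / α < 0 := div_neg_of_neg_of_pos (by linarith [hα.2]) hα.1
  have hscale : ∀ x : EReal, (((α - 1) / α : ℝ) : EReal) *
      ((r : EReal) - (((1 : ℝ) / n : ℝ) : EReal) * x) =
      (((1 : ℝ) / n : ℝ) : EReal) *
        ((((α - 1) / α : ℝ) : EReal) * (((n * r : ℝ) : EReal) - x)) := by
    have hn1 : (0 : ℝ) < 1 / n := by positivity
    intro x
    induction x with
    | bot => rw [EReal.coe_mul_bot_of_pos hn1, EReal.coe_sub_bot, EReal.coe_sub_bot,
        EReal.coe_mul_top_of_neg hc, EReal.coe_mul_bot_of_pos hn1]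
    | top => rw [EReal.coe_mul_top_of_pos hn1, EReal.sub_top, EReal.sub_top,
        EReal.coe_mul_bot_of_neg hc, EReal.coe_mul_top_of_pos hn1]
    | coe x =>
      norm_cast
      field_simp
  rw [rate, rate, hscale]
  refine mul_le_mul_of_nonneg_left ?_ (EReal.coe_nonneg.2 (by positivity))
  refine le_iInf₂ fun ρ hρ => le_iInf₂ fun σ hσ => ?_
  refine le_iSup₂_of_le (f := fun α _ => (((α - 1) / α : ℝ) : EReal) *
    (((n * r : ℝ) : EReal) - petzRenyi α ρ σ)) α hα ?_
  exact monotone_hoeffding_term hα (n * r) (iInf₂_le_of_le ρ hρ (iInf₂_le σ hσ))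

end Divergences

theorem mainTheorem4 (d : ℕ) (r : ℝ) (hr : 0 < r) (A B : ∀ n, Set (Op d n))
    (hA : IsStableStateSeq A) (hB : IsStableStateSeq B) :
    -- existence of the regularizations
    (NoRecurrentTop (hoeffdingFamily d r) A B →
      HasReg (hoeffdingFamily d r) A B (⨅ n ≥ 1, rate (hoeffdingFamily d r) A B n)) ∧
    (∀ α ∈ Set.Ioo (0 : ℝ) 1, NoRecurrentTop (petzFamily d α) A B →
      HasReg (petzFamily d α) A B (⨅ n ≥ 1, rate (petzFamily d α) A B n)) ∧
    -- the inequality between the regularized Hoeffding divergences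
    (∀ (h : EReal) (D : ℝ → EReal), HasReg (hoeffdingFamily d r) A B h →
      (∀ α ∈ Set.Ioo (0 : ℝ) 1, HasReg (petzFamily d α) A B (D α)) →
      h ≥ hoeffdingOf r D) ∧
    -- the same inequality for the lower and upper regularizations, and for the infima
    lowerReg (hoeffdingFamily d r) A B ≥
      hoeffdingOf r (fun α => lowerReg (petzFamily d α) A B) ∧
    upperReg (hoeffdingFamily d r) A B ≥
      hoeffdingOf r (fun α => upperReg (petzFamily d α) A B) ∧
    (⨅ n ≥ 1, rate (hoeffdingFamily d r) A B n) ≥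
      hoeffdingOf r (fun α => ⨅ n ≥ 1, rate (petzFamily d α) A B n) := by
  -- each term of the Hoeffding formula is monotone and continuous on `EReal`, so the bound at each
  -- `n` passes to limits, lower limits, upper limits and infima
  have hev : ∀ α ∈ Set.Ioo (0 : ℝ) 1, ∀ᶠ n in atTop,
      (((α - 1) / α : ℝ) : EReal) * ((r : EReal) - rate (petzFamily d α) A B n) ≤
        rate (hoeffdingFamily d r) A B n := fun α hα => by
    filter_upwards [eventually_ge_atTop 1] with n hn
    exact hoeffding_term_rate_le hα r A B hn
  refine ⟨?_, ?_, ?_, ?_, ?_, ?_⟩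
  · exact hasReg_of_tensor_le hA hB (fun n ρ hρ σ hσ => hoeffding_nonneg r hρ hσ)
      fun m n ρ hρ σ hσ ρ' hρ' σ' hσ' => hoeffding_tensor_le r hρ hσ hρ' hσ'
  · exact fun α hα => hasReg_of_tensor_le hA hB (fun n ρ hρ σ hσ => petzRenyi_nonneg hρ hσ hα)
      fun m n ρ hρ σ hσ ρ' hρ' σ' hσ' => petzRenyi_tensor_le hα hρ hσ hρ' hσ'
  · intro h D hh hD
    exact iSup₂_le fun α hα => le_of_tendsto_of_tendsto
      (((continuous_hoeffding_term hα r).tendsto _).comp (hD α hα)) hh (hev α hα)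
  · refine iSup₂_le fun α hα => ?_
    exact ((monotone_hoeffding_term hα r).map_liminf_of_continuousAt _
      (continuous_hoeffding_term hα r).continuousAt).le.trans (liminf_le_liminf (hev α hα))
  · refine iSup₂_le fun α hα => ?_
    exact ((monotone_hoeffding_term hα r).map_limsup_of_continuousAt _
      (continuous_hoeffding_term hα r).continuousAt).le.trans (limsup_le_limsup (hev α hα))
  · refine iSup₂_le fun α hα => le_iInf₂ fun n hn => ?_
    exact (monotone_hoeffding_term hα r (iInf₂_le n hn)).trans
      (hoeffding_term_rate_le hα r A B hn)
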